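/- Let $\chi$ and $\mathbb I$ be finite sets, $d=|\chi|$, $k=|\mathbb I|$. On a probability space with a filtration $(\mathcal F_i)_{i\ge 0}$ let $(X_i,a_i)_{i\ge0}$ be a controlled Markov chain: an adapted $\chi\times\mathbb I$-valued process with $\mathbb P(X_{i+1}=t\mid\mathcal F_i)=M^{(a_i)}_{X_i,t}$ almost surely for all $i\ge 0$ and $t\in\chi$, where each $M^{(l)}$, $l\in\mathbb I$, is a $\chi\times\chi$ stochastic matrix. For $(s,l)\in\chi\times\mathbb I$ let $\tau^{(0)}_{s,l}=0$ and, for $i\ge 1$, let $\tau^{(i)}_{s,l}$ be the least $n\ge1$ such that $(X_{\sigma+n},a_{\sigma+n})=(s,l)$ with $\sigma=\sum_{p<i}\tau^{(p)}_{s,l}$ ($\infty$ if there is none). For $1\le i<j\le m$ let $$\bar\eta_{i,j}=\sup\big|\mathbb P\big((X_n,a_n)_{j\le n\le m}\in B\mid X_i=s_1,a_i=l_1,\mathcal H=\hbar\big)-\mathbb P\big((X_n,a_n)_{j\le n\le m}\in B\mid X_i=s_2,a_i=l_2,\mathcal H=\hbar\big)\big|,$$ where $\mathcal H=(X_p,a_p)_{0\le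 p<i}$ and the supremum is over all sets $B$ of trajectories, all $s_1,s_2\in\chi$, $l_1,l_2\in\mathbb I$ and all histories $\hbar$ for which both conditioning events have positive probability, and let $\|\Delta_m\|=\max_{1\le i\le m}(1+\bar\eta_{i,i+1}+\dots+\bar\eta_{i,m})$. Assume: 1. (Sets) there are constants $\zeta_1,\zeta_2$ and, for every $i\geq 0$, a set $\mathcal S_i\subset\chi\times\mathbb I$ with $0<\zeta_2\le\mathbb P((X_i,a_i)\in\mathcal S_i)\le\zeta_1<1$; 2. (Return time) there is an integer $T>0$ with $\sup_{s,l,\,i\ge1}\mathbb E\big[\tau^{(i)}_{s,l}\mid\mathcal F_{\sum_{p<i}\tau^{(p)}_{s,l}}\big]<T$ almost surely; 3. (Mixing) there is a constant $C_\Delta>1$ with $\|\Delta_m\|\le C_\Delta$ for all $m\ge1$. Let $\hat M^{(l)}_{s,t}=N^{(l)}_{s,t}/N^{(l)}_s$ (with $0/0=0$) be the empirical estimator, where $N^{(l)}_s=\sum_{i=1}^m\mathbf 1[X_i=s,a_i=l]$ and $N^{(l)}_{s,t}=\sum_{i=1}^m\mathbf 1[X_i=s,X_{i+1}=t,a_i=l]$,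 and for a matrix $A$ let $\|A\|_\infty=\max_{s,t}|A_{s,t}|$ be the largest absolute value of an entry. There is a universal constant $c>1$ such that for all such chains and constants, all $\epsilon>0$, $\delta\in(0,1)$ and all $m\in\mathbb N$: if $$m>c\,\max\Big\{\frac{T}{\epsilon^2}\log\Big(\frac{dkT}{\epsilon^2\delta}\Big),\ C_\Delta^2\max\Big\{T^2,\frac1{(1-\max\{\zeta_1,1-\zeta_2\})^2}\Big\}\log\Big(\frac{dk}{\delta}\Big)\Big\},$$ then $$\mathbb P\Big(\sup_{l\in\mathbb I}\big\|\hat M^{(l)}-M^{(l)}\big\|_\infty>\epsilon\Big)<\delta.$$ -/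

import Mathlib

open MeasureTheory ProbabilityTheory
open scoped ENNReal

namespace ControlledChain

section Times

variable {Ω E : Type*}

/-- For a path `z` and a (possibly infinite) time `S`, the least `n ≥ 1` such that the path is at `e`
at time `S + n`. It is `⊤` if there is no such `n`, or if `S = ⊤`. -/
noncomputable def waitingTime (z : ℕ → E) (e : E) (S : ℕ∞) : ℕ∞ :=
  ⨅ n ∈ {n : ℕ | 0 < n ∧ ∃ k : ℕ, S = k ∧ z (k + n) = e}, (n : ℕ∞)

/-- The sum `τ⁽¹⁾ + ⋯ + τ⁽ⁱ⁾` of the first `i` return times to `e`, that is, the time of the `i`-th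
visit to `e` strictly after time `0` (and `0` for `i = 0`). -/
noncomputable def visitTime (Z : ℕ → Ω → E) (e : E) : ℕ → Ω → ℕ∞
  | 0, _ => 0
  | i + 1, ω => visitTime Z e i ω + waitingTime (fun n => Z n ω) e (visitTime Z e i ω)

/-- The `i`-th return time `τ⁽ⁱ⁾` to `e`, for `i ≥ 1`; for `i = 1` it is the first hitting time
of `e` strictly after time `0`. -/
noncomputable def returnTime (Z : ℕ → Ω → E) (e : E) (i : ℕ) (ω : Ω) : ℕ∞ :=
  waitingTime (fun n => Z n ω) e (visitTime Z e (i - 1) ω)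

theorem waitingTime_eq_coe_iff (z : ℕ → E) (e : E) (k n : ℕ) :
    waitingTime z e (k : ℕ∞) = n ↔ 0 < n ∧ z (k + n) = e ∧ ∀ j, 0 < j → j < n → z (k + j) ≠ e := by
  have hlb : ∀ j : ℕ, 0 < j → z (k + j) = e → waitingTime z e (k : ℕ∞) ≤ j := fun j hj hz =>
    iInf₂_le j ⟨hj, k, rfl, hz⟩
  have hge : ∀ N : ℕ∞, (∀ j : ℕ, 0 < j → z (k + j) = e → N ≤ j) →
      N ≤ waitingTime z e (k : ℕ∞) := by
    intro N hN
    refine le_iInf₂ fun j hj => ?_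
    obtain ⟨hj0, k', hk', hz⟩ := hj
    have : k = k' := by exact_mod_cast hk'
    subst this
    exact hN j hj0 hz
  constructor
  · intro h
    have hmin : ∀ j, 0 < j → j < n → z (k + j) ≠ e := by
      intro j hj hjn hz
      have h1 := hlb j hj hz
      rw [h] at h1
      have h2 : n ≤ j := by exact_mod_cast h1
      omega
    by_cases hn : 0 < n ∧ z (k + n) = e
    · exact ⟨hn.1, hn.2, hmin⟩
    · exfalso
      have h3 : ((n + 1 : ℕ) : ℕ∞) ≤ waitingTime z e (k : ℕ∞) := by
        refine hge _ fun j hj hz => ?_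
        have h4 : n < j := by
          rcases lt_trichotomy j n with h5 | h5 | h5
          · exact absurd hz (hmin j hj h5)
          · subst h5
            exact absurd ⟨hj, hz⟩ hn
          · exact h5
        exact_mod_cast h4
      rw [h] at h3
      have h6 : n + 1 ≤ n := by exact_mod_cast h3
      omega
  · rintro ⟨hn, hz, hmin⟩
    refine le_antisymm (hlb n hn hz) (hge _ fun j hj hzj => ?_)
    have : n ≤ j := by
      by_contra hlt
      exact hmin j hj (by omega) hzj
    exact_mod_cast this

theorem visitTime_succ_eq_coe_iff (Z : ℕ → Ω → E) (e : E) (i n : ℕ) (ω : Ω) :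
    visitTime Z e (i + 1) ω = n ↔
      ∃ k < n, visitTime Z e i ω = k ∧ Z n ω = e ∧ ∀ j, k < j → j < n → Z j ω ≠ e := by
  rw [visitTime]
  constructor
  · intro h
    have hS : visitTime Z e i ω ≠ ⊤ := by
      intro ht
      rw [ht, top_add] at h
      exact ENat.natCast_ne_top n h.symm
    obtain ⟨k, hk⟩ := ENat.ne_top_iff_exists.mp hS
    rw [← hk] at h ⊢
    have hW : waitingTime (fun n => Z n ω) e (k : ℕ∞) ≠ ⊤ := by
      intro ht
      rw [ht, add_top] at h
      exact ENat.natCast_ne_top n h.symm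
    obtain ⟨w, hw⟩ := ENat.ne_top_iff_exists.mp hW
    have hw' := (waitingTime_eq_coe_iff _ e k w).mp hw.symm
    rw [← hw] at h
    have hn : k + w = n := by exact_mod_cast h
    subst hn
    refine ⟨k, by omega, rfl, hw'.2.1, fun j hkj hj => ?_⟩
    have := hw'.2.2 (j - k) (by omega) (by omega)
    rwa [show k + (j - k) = j by omega] at this
  · rintro ⟨k, hk, hS, hz, hmin⟩
    rw [hS]
    have hw : waitingTime (fun n => Z n ω) e (k : ℕ∞) = ((n - k : ℕ) : ℕ∞) := by
      rw [waitingTime_eq_coe_iff]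
      refine ⟨by omega, ?_, fun j hj hjn => hmin _ (by omega) (by omega)⟩
      rwa [show k + (n - k) = n by omega]
    rw [hw]
    have : k + (n - k) = n := by omega
    exact_mod_cast this

theorem isStoppingTime_visitTime [MeasurableSpace E] [MeasurableSingletonClass E]
    {mΩ : MeasurableSpace Ω} {F : Filtration ℕ mΩ} {Z : ℕ → Ω → E} (hZ : Adapted F Z) (e : E)
    (i : ℕ) : IsStoppingTime F (visitTime Z e i) := by
  induction i with
  | zero => exact isStoppingTime_const F 0
  | succ i ih =>
    refine isStoppingTime_of_measurableSet_eq fun n => ?_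
    have hmeas : ∀ j, j ≤ n → MeasurableSet[F n] {ω | Z j ω = e} := fun j hj =>
      F.mono hj _ (hZ j (measurableSet_singleton e))
    have hset : {ω | visitTime Z e (i + 1) ω = (n : ℕ∞)} =
        ⋃ k ∈ Set.Iio n, ({ω | visitTime Z e i ω = (k : ℕ∞)} ∩ ({ω | Z n ω = e} ∩
          ⋂ j ∈ Set.Ioo k n, {ω | Z j ω = e}ᶜ)) := by
      ext ω
      simp only [Set.mem_iUnion, Set.mem_inter_iff, Set.mem_iInter, Set.mem_compl_iff]
      refine (visitTime_succ_eq_coe_iff Z e i n ω).trans ⟨?_, ?_⟩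
      · rintro ⟨k, hk, h1, h2, h3⟩
        exact ⟨k, hk, h1, h2, fun j hj => h3 j hj.1 hj.2⟩
      · rintro ⟨k, hk, h1, h2, h3⟩
        exact ⟨k, hk, h1, h2, fun j hj1 hj2 => h3 j ⟨hj1, hj2⟩⟩
    refine (congrArg (fun s => MeasurableSet[F n] s) hset).mpr ?_
    refine MeasurableSet.biUnion (Set.to_countable _) fun k hk => ?_
    refine MeasurableSet.inter (ih.measurableSet_eq_le (le_of_lt hk)) ?_
    refine MeasurableSet.inter (hmeas n le_rfl) ?_
    refine MeasurableSet.biInter (Set.to_countable _) fun j hj => ?_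
    exact (hmeas j (le_of_lt hj.2)).compl

/-- Return time condition: almost surely, the conditional expected return times
`𝔼[τ_e⁽ⁱ⁾ | F_{τ_e⁽¹⁾ + ⋯ + τ_e⁽ⁱ⁻¹⁾}]`, `e ∈ E`, `i ≥ 1`, have a supremum that is less than `T`.
(The index `i` below is `i - 1` of this formula.) -/
def ReturnTimeCondition [MeasurableSpace E] [MeasurableSingletonClass E]
    {mΩ : MeasurableSpace Ω} (μ : Measure Ω) {F : Filtration ℕ mΩ} {Z : ℕ → Ω → E}
    (hZ : Adapted F Z) (T : ℕ) : Prop :=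
  ∀ᵐ ω ∂μ,
    (⨆ (e : E) (i : ℕ),
      condLExp (isStoppingTime_visitTime hZ e i).measurableSpace μ
        (fun ω' => (returnTime Z e (i + 1) ω' : ℝ≥0∞)) ω) < (T : ℝ≥0∞)

/-- Non-degeneracy of the one-time marginals: with two constants `ζ₁, ζ₂`, at every time `i` some set
`S_i` satisfies `0 < ζ₂ ≤ ℙ(Z_i ∈ S_i) ≤ ζ₁ < 1`. -/
def SetsCondition {mΩ : MeasurableSpace Ω} (μ : Measure Ω) (Z : ℕ → Ω → E) (ζ₁ ζ₂ : ℝ) : Prop :=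
  0 < ζ₂ ∧ ζ₁ < 1 ∧ ∀ i, ∃ S : Set E, ζ₂ ≤ μ.real {ω | Z i ω ∈ S} ∧ μ.real {ω | Z i ω ∈ S} ≤ ζ₁

/-- The event that the process has the history `h` at the times `0, …, i - 1` and is at `e` at
time `i`. -/
def historyEvent (Z : ℕ → Ω → E) (i : ℕ) (h : Fin i → E) (e : E) : Set Ω :=
  {ω | (∀ p : Fin i, Z p ω = h p) ∧ Z i ω = e}

/-- The weak mixing coefficient `η̄_{i,j}` of the process `Z_0, …, Z_m`: the supremum of
`|ℙ((Z_j, …, Z_m) ∈ B | Z_i = e₁, history h) - ℙ((Z_j, …, Z_m) ∈ B | Z_i = e₂, history h)|` over all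
`B`, `e₁`, `e₂` and all histories `h` at the times `0, …, i - 1` for which both conditioning events
have positive probability. -/
noncomputable def etaBar {mΩ : MeasurableSpace Ω} (μ : Measure Ω) (Z : ℕ → Ω → E) (m i j : ℕ) : ℝ :=
  sSup {r : ℝ | ∃ (B : Set (Finset.Icc j m → E)) (e₁ e₂ : E) (h : Fin i → E),
    0 < μ (historyEvent Z i h e₁) ∧ 0 < μ (historyEvent Z i h e₂) ∧
    r = |(cond μ (historyEvent Z i h e₁)).real {ω | (fun n : Finset.Icc j m => Z n ω) ∈ B} -
         (cond μ (historyEvent Z i h e₂)).real {ω | (fun n : Finset.Icc j m => Z n ω) ∈ B}|}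

/-- `‖Δ_m‖ = max_{1 ≤ i ≤ m} (1 + η̄_{i,i+1} + ⋯ + η̄_{i,m})`. -/
noncomputable def deltaNorm {mΩ : MeasurableSpace Ω} (μ : Measure Ω) (Z : ℕ → Ω → E) (m : ℕ) : ℝ :=
  ⨆ i : Finset.Icc 1 m, (1 + ∑ j ∈ Finset.Icc ((i : ℕ) + 1) m, etaBar μ Z m i j)

/-- Summable mixing: `‖Δ_m‖ ≤ C` with a constant `C > 1` that does not depend on `m`. -/
def MixingCondition {mΩ : MeasurableSpace Ω} (μ : Measure Ω) (Z : ℕ → Ω → E) (C : ℝ) : Prop :=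
  1 < C ∧ ∀ m, 1 ≤ m → deltaNorm μ Z m ≤ C

end Times

section Chain

variable {Ω χ I : Type*}

/-- The paired process `Z_i = (X_i, a_i)` of states and controls. -/
def pair (X : ℕ → Ω → χ) (a : ℕ → Ω → I) (i : ℕ) (ω : Ω) : χ × I := (X i ω, a i ω)

/-- A controlled Markov chain with states `X`, controls `a` and transition matrices `M l`, `l ∈ I`:
the pair process is adapted to the filtration `F`, and
`ℙ(X_{i+1} = t | F_i) = M^{(a_i)}(X_i, t)` almost surely. -/
structure IsControlledMarkovChain [MeasurableSpace χ] [MeasurableSpace I] [Fintype χ]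
    [DecidableEq χ] {mΩ : MeasurableSpace Ω} (μ : Measure Ω) (F : Filtration ℕ mΩ)
    (X : ℕ → Ω → χ) (a : ℕ → Ω → I) (M : I → Matrix χ χ ℝ) : Prop where
  adapted : Adapted F (pair X a)
  stochastic : ∀ l, M l ∈ Matrix.rowStochastic ℝ χ
  markov : ∀ i t, μ⟦{ω | X (i + 1) ω = t} | F i⟧ =ᵐ[μ] fun ω => M (a i ω) (X i ω) t

open scoped Classical in
/-- `N_s^{(l)}`: the number of times `1 ≤ i ≤ m` with `X_i = s`, `a_i = l`. -/
noncomputable def visits (X : ℕ → Ω → χ) (a : ℕ → Ω → I) (m : ℕ) (l : I) (s : χ) (ω : Ω) : ℕ :=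
  ∑ i ∈ Finset.Icc 1 m, if X i ω = s ∧ a i ω = l then 1 else 0

open scoped Classical in
/-- `N_{s,t}^{(l)}`: the number of times `1 ≤ i ≤ m` with `X_i = s`, `X_{i+1} = t`, `a_i = l`. -/
noncomputable def transitions (X : ℕ → Ω → χ) (a : ℕ → Ω → I) (m : ℕ) (l : I) (s t : χ) (ω : Ω) :
    ℕ :=
  ∑ i ∈ Finset.Icc 1 m, if X i ω = s ∧ X (i + 1) ω = t ∧ a i ω = l then 1 else 0

/-- The empirical estimator `M̂_{s,t}^{(l)} = N_{s,t}^{(l)} / N_s^{(l)}` (with `0 / 0 = 0`). -/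
noncomputable def estimator (X : ℕ → Ω → χ) (a : ℕ → Ω → I) (m : ℕ) (l : I) (ω : Ω) :
    Matrix χ χ ℝ :=
  Matrix.of fun s t => (transitions X a m l s t ω : ℝ) / (visits X a m l s ω : ℝ)

/-- The largest absolute value of an entry of a matrix. -/
noncomputable def entryNorm (A : Matrix χ χ ℝ) : ℝ := ⨆ p : χ × χ, |A p.1 p.2|

end Chain

end ControlledChain

/-!
The error of an entry `(s, t)` of the estimator for the control `l` is the deviation of the number of
transitions `(s, l) → t` from `M l s t` times the number `N` of visits to `(s, l)`, divided by `N`. Two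
things have to be excluded: that this deviation is large relative to `N`, and that `N` is small.

The deviation is a sum of martingale differences that vanish unless the chain is at `(s, l)`. Hence
`exp (r · deviation - r² N / 2)` is dominated by a supermartingale started at `1`, and since the random
`N` itself appears in the exponent, Markov's inequality shows that `|deviation| > ε N` and `N ≥ q`
together have probability at most `2 exp (- ε² q / 2)` (`measureReal_transition_deviation_le`).

For the number of visits, consider its Doob martingale with respect to the history of the pair process,
started at the conditional expectation given `(X₀, a₀)`. Its difference at time `i ≥ 1` compares the
expected numbers of visits for two values at time `i` with the same past, and is therefore at most
`1 + η̄_{i,i+1} + ⋯ + η̄_{i,m} ≤ ‖Δ_m‖` (`abs_condAvg_visitCount_sub_le`). The same exponential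
supermartingale gives concentration (`measureReal_visitCount_lt_le`). The return time condition shows
that, given the value at time `0`, the `n`-th visit takes an expected time of at most `n T`, so that
for `n = ⌊m / (2 T)⌋` it happens by time `m` with conditional probability at least `1 / 2`, and the
starting value of the martingale is at least `n / 2` (`half_le_condAvg_visitCount`).

A union bound over the pairs and triples, with `q = n / 4`, finishes the proof for `ε < 1`; for `ε ≥ 1`
the event is empty. The non-degeneracy of the marginals forces `2 ≤ d k`, which keeps
`log (d k / δ)` bounded away from zero.
-/

namespace ControlledChain

/-! ### An exponential tail bound for martingale differences -/

section Exponential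

variable {Ω : Type*} {mΩ : MeasurableSpace Ω} {μ : Measure Ω}

/-- The exponential process `exp (∑_{i < n} (r Vᵢ - r² Yᵢ / 2))`. It is a supermartingale if the `Vᵢ`
are martingale differences with `|Vᵢ| ≤ Yᵢ` and the `Yᵢ` take the values `0` and `1`. -/
noncomputable def expWeight (V Y : ℕ → Ω → ℝ) (r : ℝ) (n : ℕ) (ω : Ω) : ℝ :=
  Real.exp (∑ i ∈ Finset.range n, (r * V i ω - r ^ 2 / 2 * Y i ω))

theorem measurable_expWeight {m : MeasurableSpace Ω} {V Y : ℕ → Ω → ℝ} {n : ℕ}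
    (hV : ∀ i < n, Measurable[m] (V i)) (hY : ∀ i < n, Measurable[m] (Y i)) (r : ℝ) :
    Measurable[m] (expWeight V Y r n) := by
  unfold expWeight
  refine Real.measurable_exp.comp (Finset.measurable_sum _ fun i hi => ?_)
  have hi' := Finset.mem_range.mp hi
  exact ((hV i hi').const_mul r).sub ((hY i hi').const_mul _)

/-- The pointwise inequality behind the supermartingale property: the upper bound is affine in `v`,
with a slope that does not depend on `v` and `y`. -/
theorem exp_sub_le_one_add_mul {v y : ℝ} (hvy : |v| ≤ y) (hy : y = 0 ∨ y = 1) (r : ℝ) :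
    Real.exp (r * v - r ^ 2 / 2 * y) ≤ 1 + Real.exp (-(r ^ 2 / 2)) * Real.sinh r * v := by
  rcases hy with rfl | rfl
  · have : v = 0 := by simpa using hvy
    simp [this]
  · have h1 := Real.exp_mul_le_cosh_add_mul_sinh hvy r
    have h2 : Real.exp (r * v) ≤ Real.exp (r ^ 2 / 2) + v * Real.sinh r := by
      have := Real.cosh_le_exp_half_sq r
      rw [mul_comm r v]
      linarith
    have h3 : Real.exp (-(r ^ 2 / 2)) * Real.exp (r ^ 2 / 2) = 1 := by
      rw [← Real.exp_add]
      simp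
    calc Real.exp (r * v - r ^ 2 / 2 * 1)
        = Real.exp (-(r ^ 2 / 2)) * Real.exp (r * v) := by
          rw [← Real.exp_add]
          ring_nf
      _ ≤ Real.exp (-(r ^ 2 / 2)) * (Real.exp (r ^ 2 / 2) + v * Real.sinh r) := by gcongr
      _ = 1 + Real.exp (-(r ^ 2 / 2)) * Real.sinh r * v := by
          rw [mul_add, h3]
          ring

theorem expWeight_succ (V Y : ℕ → Ω → ℝ) (r : ℝ) (n : ℕ) (ω : Ω) :
    expWeight V Y r (n + 1) ω =
      expWeight V Y r n ω * Real.exp (r * V n ω - r ^ 2 / 2 * Y n ω) := by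
  rw [expWeight, Finset.sum_range_succ, Real.exp_add]
  rfl

theorem expWeight_bound {V Y : ℕ → Ω → ℝ} {n : ℕ}
    (hVY : ∀ i < n, ∀ᵐ ω ∂μ, |V i ω| ≤ Y i ω ∧ (Y i ω = 0 ∨ Y i ω = 1)) (r : ℝ) :
    ∀ᵐ ω ∂μ, ‖expWeight V Y r n ω‖ ≤ Real.exp (n * |r|) := by
  have hall : ∀ᵐ ω ∂μ, ∀ i, i < n → |V i ω| ≤ Y i ω ∧ (Y i ω = 0 ∨ Y i ω = 1) := by
    rw [ae_all_iff]
    intro i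
    by_cases hi : i < n
    · simpa [hi] using hVY i hi
    · simp [hi]
  filter_upwards [hall] with ω hω
  rw [expWeight, Real.norm_eq_abs, abs_of_pos (Real.exp_pos _), Real.exp_le_exp]
  calc ∑ i ∈ Finset.range n, (r * V i ω - r ^ 2 / 2 * Y i ω)
      ≤ ∑ _i ∈ Finset.range n, |r| := by
        refine Finset.sum_le_sum fun i hi => ?_
        obtain ⟨h1, h2⟩ := hω i (Finset.mem_range.mp hi)
        have h3 : r * V i ω ≤ |r| * |V i ω| := by
          rw [← abs_mul]
          exact le_abs_self _
        have h4 : |r| * |V i ω| ≤ |r| * 1 := by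
          gcongr
          rcases h2 with h2 | h2 <;> linarith
        have h5 : 0 ≤ Y i ω := (abs_nonneg _).trans h1
        have h6 : 0 ≤ r ^ 2 / 2 * Y i ω := by positivity
        linarith
    _ = n * |r| := by simp

theorem integral_expWeight_le_one [IsProbabilityMeasure μ] {V Y : ℕ → Ω → ℝ}
    (hV : ∀ i, Measurable (V i)) (hY : ∀ i, Measurable (Y i)) (n : ℕ)
    (hVY : ∀ i < n, ∀ᵐ ω ∂μ, |V i ω| ≤ Y i ω ∧ (Y i ω = 0 ∨ Y i ω = 1)) (r : ℝ)
    (horth : ∀ k < n, ∫ ω, expWeight V Y r k ω * V k ω ∂μ = 0) :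
    ∫ ω, expWeight V Y r n ω ∂μ ≤ 1 := by
  have hmeas : ∀ k, Measurable (expWeight V Y r k) := fun k =>
    measurable_expWeight (fun i _ => hV i) (fun i _ => hY i) r
  have hint : ∀ k ≤ n, Integrable (expWeight V Y r k) μ := fun k hk =>
    Integrable.of_bound (hmeas k).aestronglyMeasurable _
      (expWeight_bound (fun i hi => hVY i (hi.trans_le hk)) r)
  induction n with
  | zero => simp [expWeight]
  | succ n ih =>
    have ih' := ih (fun i hi => hVY i (by omega)) (fun k hk => horth k (by omega))
      (fun k hk => hint k (by omega))
    have hWV : Integrable (fun ω => expWeight V Y r n ω * V n ω) μ := by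
      refine (hint n (by omega)).mul_bdd (c := 1) (hV n).aestronglyMeasurable ?_
      filter_upwards [hVY n (by omega)] with ω hω
      rw [Real.norm_eq_abs]
      rcases hω.2 with h | h <;> linarith [hω.1]
    set K := Real.exp (-(r ^ 2 / 2)) * Real.sinh r
    calc ∫ ω, expWeight V Y r (n + 1) ω ∂μ
        ≤ ∫ ω, (expWeight V Y r n ω + K * (expWeight V Y r n ω * V n ω)) ∂μ := by
          refine integral_mono_ae (hint _ le_rfl) ((hint n (by omega)).add (hWV.const_mul K)) ?_
          filter_upwards [hVY n (by omega)] with ω hω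
          rw [expWeight_succ]
          have h1 := exp_sub_le_one_add_mul hω.1 hω.2 r
          have h2 : 0 ≤ expWeight V Y r n ω := (Real.exp_pos _).le
          calc _ ≤ expWeight V Y r n ω * (1 + K * V n ω) := by gcongr
            _ = _ := by ring
      _ = ∫ ω, expWeight V Y r n ω ∂μ := by
          rw [integral_add (hint n (by omega)) (hWV.const_mul K), integral_const_mul,
            horth n (by omega)]
          simp
      _ ≤ 1 := ih'

/-- The tail bound that follows from the exponential supermartingale by Markov's inequality. -/
theorem measureReal_le_exp_neg [IsProbabilityMeasure μ] {V Y : ℕ → Ω → ℝ}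
    (hV : ∀ i, Measurable (V i)) (hY : ∀ i, Measurable (Y i)) (n : ℕ)
    (hVY : ∀ i < n, ∀ᵐ ω ∂μ, |V i ω| ≤ Y i ω ∧ (Y i ω = 0 ∨ Y i ω = 1)) (r : ℝ)
    (horth : ∀ k < n, ∫ ω, expWeight V Y r k ω * V k ω ∂μ = 0) (b : ℝ) :
    μ.real {ω | b ≤ ∑ i ∈ Finset.range n, (r * V i ω - r ^ 2 / 2 * Y i ω)} ≤ Real.exp (-b) := by
  have hint : Integrable (expWeight V Y r n) μ :=
    Integrable.of_bound (measurable_expWeight (fun i _ => hV i)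
      (fun i _ => hY i) r).aestronglyMeasurable _ (expWeight_bound hVY r)
  have h1 := mul_meas_ge_le_integral_of_nonneg (μ := μ)
    (Filter.Eventually.of_forall fun ω => (Real.exp_pos _).le :
      0 ≤ᵐ[μ] expWeight V Y r n) hint (Real.exp b)
  have h2 := h1.trans (integral_expWeight_le_one hV hY n hVY r horth)
  have h3 : {ω | Real.exp b ≤ expWeight V Y r n ω} =
      {ω | b ≤ ∑ i ∈ Finset.range n, (r * V i ω - r ^ 2 / 2 * Y i ω)} := by
    ext ω
    simp [expWeight]
  rw [h3] at h2
  rw [Real.exp_neg, ← one_div, le_div_iff₀ (Real.exp_pos b), mul_comm]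
  exact h2

end Exponential

/-! ### Conditional averages given a random variable with finitely many values -/

section CondAvg

variable {Ω α β : Type*} {mΩ : MeasurableSpace Ω} {μ : Measure Ω}

/-- The conditional expectation of `f` given a random variable `H` with finitely many values, as an
average over the level sets of `H`. It is `0` on the level sets of measure zero. -/
noncomputable def condAvg (μ : Measure Ω) (H : Ω → α) (f : Ω → ℝ) (ω : Ω) : ℝ :=
  ∫ ω', f ω' ∂(cond μ (H ⁻¹' {H ω}))

theorem condAvg_congr {H : Ω → α} {f : Ω → ℝ} {ω ω' : Ω} (h : H ω = H ω') :
    condAvg μ H f ω = condAvg μ H f ω' := by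
  rw [condAvg, condAvg, h]

theorem condAvg_factors (μ : Measure Ω) (H : Ω → α) (f : Ω → ℝ) :
    ∃ φ : α → ℝ, ∀ ω, condAvg μ H f ω = φ (H ω) :=
  ⟨fun x => ∫ ω', f ω' ∂(cond μ (H ⁻¹' {x})), fun _ => rfl⟩

theorem measureReal_mul_condAvg [IsFiniteMeasure μ] (H : Ω → α) (f : Ω → ℝ) (ω : Ω) :
    μ.real (H ⁻¹' {H ω}) * condAvg μ H f ω = ∫ ω' in H ⁻¹' {H ω}, f ω' ∂μ := by
  rw [condAvg, ProbabilityTheory.cond, integral_smul_measure, smul_eq_mul, ENNReal.toReal_inv]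
  by_cases h : μ (H ⁻¹' {H ω}) = 0
  · rw [Measure.restrict_eq_zero.mpr h]
    simp
  · exact mul_inv_cancel_left₀ (ENNReal.toReal_ne_zero.mpr ⟨h, measure_ne_top _ _⟩) _

variable [MeasurableSpace α] [MeasurableSingletonClass α]

theorem ae_pos_fiber [Finite α] {H : Ω → α} (hH : Measurable H) : ∀ᵐ ω ∂μ, 0 < μ (H ⁻¹' {H ω}) := by
  have h : ∀ᵐ x ∂(μ.map H), 0 < μ (H ⁻¹' {x}) := by
    rw [ae_iff_of_countable]
    intro x hx
    rw [Measure.map_apply hH (measurableSet_singleton x)] at hx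
    exact pos_iff_ne_zero.mpr hx
  exact ae_of_ae_map hH.aemeasurable h

theorem integrable_comp_of_finite [Finite α] [IsFiniteMeasure μ] {H : Ω → α}
    (hH : Measurable H) (φ : α → ℝ) :
    Integrable (fun ω => φ (H ω)) μ :=
  (Integrable.of_finite : Integrable φ (μ.map H)).comp_measurable hH

theorem integrable_comp_mul [Finite α] {H : Ω → α} (hH : Measurable H) (φ : α → ℝ) {f : Ω → ℝ}
    (hf : Integrable f μ) : Integrable (fun ω => φ (H ω) * f ω) μ := by
  obtain ⟨C, hC⟩ := (Set.finite_range fun x => ‖φ x‖).bddAbove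
  exact hf.bdd_mul (c := C) ((Measurable.of_discrete (f := φ)).comp hH).aestronglyMeasurable
    (Filter.Eventually.of_forall fun ω => hC ⟨H ω, rfl⟩)

theorem measurable_condAvg [Finite α] {H : Ω → α} (hH : Measurable H) (f : Ω → ℝ) :
    Measurable (condAvg μ H f) := by
  obtain ⟨φ, hφ⟩ := condAvg_factors μ H f
  rw [funext hφ]
  exact (Measurable.of_discrete (f := φ)).comp hH

variable [IsFiniteMeasure μ]

theorem setIntegral_fiber_condAvg {H : Ω → α} (hH : Measurable H) (f : Ω → ℝ) (x : α) :
    ∫ ω in H ⁻¹' {x}, condAvg μ H f ω ∂μ = ∫ ω in H ⁻¹' {x}, f ω ∂μ := by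
  have hmeas : MeasurableSet (H ⁻¹' {x}) := hH (measurableSet_singleton x)
  rcases (H ⁻¹' {x}).eq_empty_or_nonempty with h | ⟨ω₀, rfl⟩
  · simp [h]
  · rw [setIntegral_congr_fun hmeas (g := fun _ => condAvg μ H f ω₀)
      (fun ω hω => condAvg_congr hω), setIntegral_const, smul_eq_mul, measureReal_mul_condAvg]

/-- The averaging property that characterizes the conditional expectation. -/
theorem integral_comp_mul_condAvg [Finite α] {H : Ω → α} (hH : Measurable H) {f : Ω → ℝ}
    (hf : Integrable f μ) (φ : α → ℝ) :
    ∫ ω, φ (H ω) * condAvg μ H f ω ∂μ = ∫ ω, φ (H ω) * f ω ∂μ := by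
  have := Fintype.ofFinite α
  have hsum : ∀ g : Ω → ℝ, Integrable g μ →
      ∫ ω, φ (H ω) * g ω ∂μ = ∑ x : α, φ x * ∫ ω in H ⁻¹' {x}, g ω ∂μ := by
    intro g hg
    have hU : (⋃ x ∈ (Finset.univ : Finset α), H ⁻¹' {x}) = Set.univ := by
      ext ω
      simp
    rw [← setIntegral_univ, ← hU, integral_biUnion_finset]
    · refine Finset.sum_congr rfl fun x _ => ?_
      rw [← integral_const_mul]
      refine setIntegral_congr_fun (hH (measurableSet_singleton x)) fun ω hω => ?_
      have : H ω = x := hω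
      simp [this]
    · exact fun x _ => hH (measurableSet_singleton x)
    · intro x _ y _ hxy
      exact Disjoint.preimage H (Set.disjoint_singleton.mpr hxy)
    · exact fun x _ => (integrable_comp_mul hH φ hg).integrableOn
  obtain ⟨ψ, hψ⟩ := condAvg_factors μ H f
  have hg : Integrable (condAvg μ H f) μ := by
    rw [funext hψ]
    exact integrable_comp_of_finite hH ψ
  rw [hsum _ hg, hsum _ hf]
  simp_rw [setIntegral_fiber_condAvg hH]

/-- The conditional average over a coarser partition is an average of the conditional averages over
the finer one, so it is as close to each of them as these are to each other. -/
theorem abs_condAvg_sub_condAvg_comp_le [Finite β] [MeasurableSpace β]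
    [MeasurableSingletonClass β] {H : Ω → β} (hH : Measurable H) {f : Ω → ℝ}
    (hf : Integrable f μ) (π : β → α) (D : ℝ)
    (hD : ∀ ω₁ ω₂, π (H ω₁) = π (H ω₂) → 0 < μ (H ⁻¹' {H ω₁}) → 0 < μ (H ⁻¹' {H ω₂}) →
      |condAvg μ H f ω₁ - condAvg μ H f ω₂| ≤ D) :
    ∀ᵐ ω ∂μ, |condAvg μ H f ω - condAvg μ (π ∘ H) f ω| ≤ D := by
  classical
  filter_upwards [ae_pos_fiber hH] with ω hω
  set A : Set Ω := (π ∘ H) ⁻¹' {(π ∘ H) ω} with hA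
  have hAm : MeasurableSet A := (Measurable.of_discrete.comp hH) (measurableSet_singleton _)
  have hsub : H ⁻¹' {H ω} ⊆ A := fun ω' h => by
    have : H ω' = H ω := h
    simp [hA, this]
  have hApos : 0 < μ.real A :=
    ENNReal.toReal_pos (hω.trans_le (measure_mono hsub)).ne' (measure_ne_top _ _)
  obtain ⟨ψ, hψ⟩ := condAvg_factors μ H f
  have hu : Integrable (condAvg μ H f) μ := by
    rw [funext hψ]
    exact integrable_comp_of_finite hH ψ
  -- the fine conditional average has the same integral over `A` as `f`
  have h1 : ∫ ω' in A, condAvg μ H f ω' ∂μ = μ.real A * condAvg μ (π ∘ H) f ω := by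
    rw [measureReal_mul_condAvg, ← integral_indicator hAm, ← integral_indicator hAm]
    have h2 := integral_comp_mul_condAvg hH hf
      (fun y => if π y = π (H ω) then (1 : ℝ) else 0)
    have h3 : ∀ g : Ω → ℝ, (fun ω' => (if π (H ω') = π (H ω) then (1 : ℝ) else 0) * g ω') =
        A.indicator g := by
      intro g
      ext ω'
      by_cases h : π (H ω') = π (H ω) <;> simp [hA, Set.indicator, h]
    simp only [h3] at h2
    exact h2
  have h4 : ∫ ω' in A, (condAvg μ H f ω - condAvg μ H f ω') ∂μ =
      μ.real A * (condAvg μ H f ω - condAvg μ (π ∘ H) f ω) := by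
    rw [integral_sub (integrable_const _) hu.integrableOn, h1, setIntegral_const, smul_eq_mul]
    ring
  have h5 : ‖∫ ω' in A, (condAvg μ H f ω - condAvg μ H f ω') ∂μ‖ ≤ D * μ.real A := by
    refine norm_setIntegral_le_of_norm_le_const_ae' (measure_lt_top _ _) ?_
    filter_upwards [ae_pos_fiber (μ := μ) hH] with ω' hω' hmem
    exact hD ω ω' (Eq.symm hmem) hω hω'
  rw [h4, Real.norm_eq_abs, abs_mul, abs_of_pos hApos, mul_comm] at h5
  exact le_of_mul_le_mul_right h5 hApos

end CondAvg

/-! ### Deviations of the transition counts -/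

section Transitions

variable {Ω χ I : Type*} {mΩ : MeasurableSpace Ω} {μ : Measure Ω}

theorem integral_mul_indicator_eq_integral_mul_condExp [IsFiniteMeasure μ] {m : MeasurableSpace Ω}
    (hm : m ≤ mΩ) {φ : Ω → ℝ} (hφ : Measurable[m] φ) (hint : Integrable φ μ) {B : Set Ω}
    (hB : MeasurableSet[mΩ] B) :
    ∫ ω, φ ω * B.indicator (fun _ => (1 : ℝ)) ω ∂μ = ∫ ω, φ ω * (μ⟦B | m⟧) ω ∂μ := by
  have h1 : Integrable (B.indicator (fun _ => (1 : ℝ))) μ := (integrable_const 1).indicator hB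
  have h2 : Integrable (φ * B.indicator (fun _ => (1 : ℝ))) μ := by
    refine hint.mul_bdd (c := 1) h1.aestronglyMeasurable (Filter.Eventually.of_forall fun ω => ?_)
    by_cases h : ω ∈ B <;> simp [h]
  have h3 := condExp_mul_of_stronglyMeasurable_left hφ.stronglyMeasurable h2 h1
  have h4 := integral_condExp hm (f := φ * B.indicator (fun _ => (1 : ℝ))) (μ := μ)
  rw [integral_congr_ae h3] at h4
  exact h4.symm

/-- The indicator of the event that the chain is at `(s, l)` at time `i + 1`. -/
noncomputable def atPair (X : ℕ → Ω → χ) (a : ℕ → Ω → I) (l : I) (s : χ) (i : ℕ) : Ω → ℝ :=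
  {ω | pair X a (i + 1) ω = (s, l)}.indicator fun _ => 1

/-- The deviation of the transition out of `(s, l)` at time `i + 1` from its conditional
probability `p`: if the chain is at `(s, l)`, this is `1 - p` or `-p`, and it is `0` otherwise. -/
noncomputable def transitionDev (X : ℕ → Ω → χ) (a : ℕ → Ω → I) (l : I) (s t : χ) (p : ℝ) (i : ℕ)
    (ω : Ω) : ℝ :=
  atPair X a l s i ω * ({ω | X (i + 2) ω = t}.indicator (fun _ => 1) ω - p)

theorem visits_eq_sum (X : ℕ → Ω → χ) (a : ℕ → Ω → I) (m : ℕ) (l : I) (s : χ) (ω : Ω) :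
    (visits X a m l s ω : ℝ) = ∑ i ∈ Finset.range m, atPair X a l s i ω := by
  rw [visits, Finset.range_eq_Ico]
  simp only [atPair]
  rw [Finset.sum_Ico_add' (fun i =>
    ({ω | pair X a i ω = (s, l)}.indicator (fun _ => (1 : ℝ)) ω)) 0 m 1]
  push_cast
  refine Finset.sum_congr ?_ fun i _ => ?_
  · rfl
  · by_cases h1 : X i ω = s <;> by_cases h2 : a i ω = l <;> simp [pair, h1, h2]

theorem transitions_sub_eq_sum (X : ℕ → Ω → χ) (a : ℕ → Ω → I) (m : ℕ) (l : I) (s t : χ) (p : ℝ)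
    (ω : Ω) : (transitions X a m l s t ω : ℝ) - p * visits X a m l s ω =
      ∑ i ∈ Finset.range m, transitionDev X a l s t p i ω := by
  have h : (transitions X a m l s t ω : ℝ) = ∑ i ∈ Finset.range m,
      atPair X a l s i ω * {ω | X (i + 2) ω = t}.indicator (fun _ => (1 : ℝ)) ω := by
    rw [transitions, Finset.range_eq_Ico]
    simp only [atPair]
    rw [Finset.sum_Ico_add' (fun i => ({ω | pair X a i ω = (s, l)}.indicator
      (fun _ => (1 : ℝ)) ω) * {ω | X (i + 1) ω = t}.indicator (fun _ => (1 : ℝ)) ω) 0 m 1]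
    push_cast
    refine Finset.sum_congr ?_ fun i _ => ?_
    · rfl
    · by_cases h1 : X i ω = s <;> by_cases h2 : X (i + 1) ω = t <;> by_cases h3 : a i ω = l <;>
        simp [pair, h1, h2, h3]
  rw [h, visits_eq_sum, Finset.mul_sum, ← Finset.sum_sub_distrib]
  refine Finset.sum_congr rfl fun i _ => ?_
  rw [transitionDev]
  ring

variable [Fintype χ] [DecidableEq χ] [MeasurableSpace χ] [MeasurableSpace I]
  {F : Filtration ℕ mΩ} {X : ℕ → Ω → χ} {a : ℕ → Ω → I} {M : I → Matrix χ χ ℝ}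

theorem IsControlledMarkovChain.entry_mem (hchain : IsControlledMarkovChain μ F X a M) (l : I)
    (s t : χ) : 0 ≤ M l s t ∧ M l s t ≤ 1 :=
  ⟨Matrix.nonneg_of_mem_rowStochastic (hchain.stochastic l),
    Matrix.le_one_of_mem_rowStochastic (hchain.stochastic l)⟩

variable [MeasurableSingletonClass χ]

theorem measurableSet_state_eq (hchain : IsControlledMarkovChain μ F X a M) (i : ℕ) (t : χ) :
    MeasurableSet[F i] {ω | X i ω = t} :=
  (measurable_fst.comp (hchain.adapted i)) (measurableSet_singleton t)

variable [MeasurableSingletonClass I]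

theorem measurable_atPair (hchain : IsControlledMarkovChain μ F X a M) (l : I) (s : χ) (i : ℕ) :
    Measurable[F (i + 1)] (atPair X a l s i) :=
  Measurable.indicator measurable_const (hchain.adapted (i + 1) (measurableSet_singleton (s, l)))

theorem measurable_transitionDev (hchain : IsControlledMarkovChain μ F X a M) (l : I) (s t : χ)
    (p : ℝ) (i : ℕ) : Measurable[F (i + 2)] (transitionDev X a l s t p i) :=
  ((measurable_atPair hchain l s i).mono (F.mono (by omega)) le_rfl).mul
    ((Measurable.indicator measurable_const (measurableSet_state_eq hchain (i + 2) t)).sub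
      measurable_const)

theorem integral_mul_transitionDev [IsFiniteMeasure μ] (hchain : IsControlledMarkovChain μ F X a M)
    (l : I) (s t : χ) (i : ℕ) {W : Ω → ℝ} (hW : Measurable[F (i + 1)] W) (hint : Integrable W μ) :
    ∫ ω, W ω * transitionDev X a l s t (M l s t) i ω ∂μ = 0 := by
  set φ : Ω → ℝ := fun ω => W ω * atPair X a l s i ω with hφ
  have hφm : Measurable[F (i + 1)] φ := hW.mul (measurable_atPair hchain l s i)
  have hφi : Integrable φ μ := by
    refine hint.mul_bdd (c := 1) ((measurable_atPair hchain l s i).mono (F.le _)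
      le_rfl).aestronglyMeasurable (Filter.Eventually.of_forall fun ω => ?_)
    by_cases h : pair X a (i + 1) ω = (s, l) <;> simp [atPair, h]
  have hB : MeasurableSet {ω | X (i + 2) ω = t} := F.le _ _ (measurableSet_state_eq hchain (i + 2) t)
  have h1 := integral_mul_indicator_eq_integral_mul_condExp (F.le (i + 1)) hφm hφi hB
  -- by the Markov property the conditional probability is `M l s t` wherever `φ` does not vanish
  have h2 : ∫ ω, φ ω * (μ⟦{ω | X (i + 2) ω = t} | F (i + 1)⟧) ω ∂μ =
      ∫ ω, φ ω * M l s t ∂μ := by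
    refine integral_congr_ae ?_
    filter_upwards [hchain.markov (i + 1) t] with ω hω
    by_cases h : pair X a (i + 1) ω = (s, l)
    · have h' : X (i + 1) ω = s ∧ a (i + 1) ω = l := by simpa [pair] using h
      change φ ω * _ = φ ω * _
      rw [hω, h'.1, h'.2]
    · simp [hφ, atPair, h]
  have h3 : ∀ ω, W ω * transitionDev X a l s t (M l s t) i ω =
      φ ω * {ω | X (i + 2) ω = t}.indicator (fun _ => (1 : ℝ)) ω - φ ω * M l s t := by
    intro ω
    rw [hφ, transitionDev]
    ring
  have h4 : Integrable (fun ω => φ ω * {ω | X (i + 2) ω = t}.indicator (fun _ => (1 : ℝ)) ω) μ := by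
    refine hφi.mul_bdd (c := 1) (measurable_const.indicator hB).aestronglyMeasurable
      (Filter.Eventually.of_forall fun ω => ?_)
    by_cases h : X (i + 2) ω = t <;> simp [h]
  simp_rw [h3]
  rw [integral_sub h4 (hφi.mul_const _), h1, h2, sub_self]

/-- Given the visits to `(s, l)`, the transitions out of `(s, l)` behave like independent trials. The
exponential weights involve the actual number of visits, which makes a union bound over the
possible numbers of visits unnecessary. -/
theorem measureReal_transition_deviation_le [IsProbabilityMeasure μ]
    (hchain : IsControlledMarkovChain μ F X a M) (l : I) (s t : χ) (m : ℕ) {ε : ℝ} (hε : 0 < ε)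
    (q : ℝ) :
    μ.real {ω | q ≤ visits X a m l s ω ∧ ε * visits X a m l s ω <
      |(transitions X a m l s t ω : ℝ) - M l s t * visits X a m l s ω|} ≤
      2 * Real.exp (-(ε ^ 2 / 2 * q)) := by
  set V := transitionDev X a l s t (M l s t) with hVdef
  set Y := atPair X a l s with hYdef
  have hp := hchain.entry_mem l s t
  have hV : ∀ i, Measurable (V i) := fun i =>
    (measurable_transitionDev hchain l s t _ i).mono (F.le _) le_rfl
  have hY : ∀ i, Measurable (Y i) := fun i => (measurable_atPair hchain l s i).mono (F.le _) le_rfl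
  have hVY : ∀ i < m, ∀ᵐ ω ∂μ, |V i ω| ≤ Y i ω ∧ (Y i ω = 0 ∨ Y i ω = 1) := by
    refine fun i _ => Filter.Eventually.of_forall fun ω => ?_
    by_cases h : pair X a (i + 1) ω = (s, l)
    · have hY1 : Y i ω = 1 := by simp [hYdef, atPair, h]
      refine ⟨?_, Or.inr hY1⟩
      rw [hVdef, transitionDev, ← hYdef, hY1, abs_le]
      by_cases h' : X (i + 2) ω = t <;> simp [h'] <;> constructor <;> linarith
    · have hY0 : Y i ω = 0 := by simp [hYdef, atPair, h]
      refine ⟨?_, Or.inl hY0⟩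
      rw [hVdef, transitionDev, ← hYdef, hY0]
      simp
  have horth : ∀ r : ℝ, ∀ k < m, ∫ ω, expWeight V Y r k ω * V k ω ∂μ = 0 := by
    intro r k hk
    have hmeas : Measurable[F (k + 1)] (expWeight V Y r k) :=
      measurable_expWeight
        (fun i hi => (measurable_transitionDev hchain l s t _ i).mono (F.mono (by omega)) le_rfl)
        (fun i hi => (measurable_atPair hchain l s i).mono (F.mono (by omega)) le_rfl) r
    refine integral_mul_transitionDev hchain l s t k hmeas ?_
    exact Integrable.of_bound (hmeas.mono (F.le _) le_rfl).aestronglyMeasurable _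
      (expWeight_bound (fun i hi => hVY i (hi.trans hk)) r)
  have hpos := measureReal_le_exp_neg hV hY m hVY ε (horth ε) (ε ^ 2 / 2 * q)
  have hneg := measureReal_le_exp_neg hV hY m hVY (-ε) (horth (-ε)) (ε ^ 2 / 2 * q)
  have hsum : ∀ r ω, ∑ i ∈ Finset.range m, (r * V i ω - r ^ 2 / 2 * Y i ω) =
      r * ((transitions X a m l s t ω : ℝ) - M l s t * visits X a m l s ω) -
        r ^ 2 / 2 * visits X a m l s ω := by
    intro r ω
    rw [transitions_sub_eq_sum, visits_eq_sum, Finset.mul_sum, Finset.mul_sum,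
      ← Finset.sum_sub_distrib]
  simp_rw [hsum] at hpos hneg
  rw [two_mul]
  refine le_trans (measureReal_mono ?_ (measure_ne_top _ _))
    ((measureReal_union_le _ _).trans (add_le_add hpos hneg))
  rintro ω ⟨h1, h2⟩
  have h3 : ε ^ 2 / 2 * q ≤ ε ^ 2 / 2 * visits X a m l s ω := by gcongr
  rcases lt_abs.mp h2 with h4 | h4
  · left
    have := mul_le_mul_of_nonneg_left h4.le hε.le
    simp only [Set.mem_ofPred_eq]
    nlinarith
  · right
    have := mul_le_mul_of_nonneg_left h4.le hε.le
    simp only [Set.mem_ofPred_eq]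
    nlinarith

end Transitions

/-! ### Concentration of the number of visits under weak mixing -/

section Visits

variable {Ω E : Type*} {mΩ : MeasurableSpace Ω} {μ : Measure Ω}

/-- The history of the process up to and including time `i`. -/
def hist (Z : ℕ → Ω → E) (i : ℕ) (ω : Ω) (p : Fin (i + 1)) : E := Z p ω

/-- The number of visits to `e` at the times `1, …, m`, as a real number. -/
noncomputable def visitCount (Z : ℕ → Ω → E) (e : E) (m : ℕ) (ω : Ω) : ℝ :=
  ∑ j ∈ Finset.Icc 1 m, {ω | Z j ω = e}.indicator (fun _ => 1) ω

theorem hist_eq_hist_iff {Z : ℕ → Ω → E} {i : ℕ} {ω ω' : Ω} :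
    hist Z i ω = hist Z i ω' ↔ ∀ p ≤ i, Z p ω = Z p ω' := by
  constructor
  · intro h p hp
    exact congrFun h ⟨p, by omega⟩
  · intro h
    funext p
    exact h p (by omega)

theorem preimage_hist_eq_historyEvent (Z : ℕ → Ω → E) (i : ℕ) (ω : Ω) :
    hist Z i ⁻¹' {hist Z i ω} = historyEvent Z i (fun p => Z p ω) (Z i ω) := by
  ext ω'
  change hist Z i ω' = hist Z i ω ↔ _
  rw [hist_eq_hist_iff]
  constructor
  · intro h
    exact ⟨fun p => h p (by omega), h i le_rfl⟩
  · rintro ⟨h1, h2⟩ p hp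
    rcases hp.lt_or_eq with hp | rfl
    · exact h1 ⟨p, hp⟩
    · exact h2

/-- The mixing coefficient bounds the influence of the value at time `i` on the distribution of the
value at a later time `j`. -/
theorem abs_cond_sub_cond_le_etaBar (Z : ℕ → Ω → E) {m i j : ℕ} (hjm : j ≤ m) (e e₁ e₂ : E)
    (h : Fin i → E) (h₁ : 0 < μ (historyEvent Z i h e₁)) (h₂ : 0 < μ (historyEvent Z i h e₂)) :
    |(ProbabilityTheory.cond μ (historyEvent Z i h e₁)).real {ω | Z j ω = e} -
      (ProbabilityTheory.cond μ (historyEvent Z i h e₂)).real {ω | Z j ω = e}| ≤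
      etaBar μ Z m i j := by
  refine le_csSup ⟨1, ?_⟩ ⟨{w | w ⟨j, Finset.mem_Icc.mpr ⟨le_rfl, hjm⟩⟩ = e}, e₁, e₂, h, h₁, h₂, rfl⟩
  rintro r ⟨B, e₁, e₂, h, -, -, rfl⟩
  exact abs_sub_le_of_nonneg_of_le measureReal_nonneg measureReal_le_one measureReal_nonneg
    measureReal_le_one

theorem sum_etaBar_le_deltaNorm (μ : Measure Ω) (Z : ℕ → Ω → E) {m i : ℕ} (hi : 1 ≤ i)
    (him : i ≤ m) : 1 + ∑ j ∈ Finset.Icc (i + 1) m, etaBar μ Z m i j ≤ deltaNorm μ Z m :=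
  le_ciSup (f := fun i : Finset.Icc 1 m =>
      (1 + ∑ j ∈ Finset.Icc ((i : ℕ) + 1) m, etaBar μ Z m i j))
    (Set.finite_range _).bddAbove ⟨i, Finset.mem_Icc.mpr ⟨hi, him⟩⟩

theorem integrable_visitCount [IsFiniteMeasure μ] [MeasurableSpace E] [MeasurableSingletonClass E]
    {Z : ℕ → Ω → E} (hZ : ∀ i, Measurable (Z i)) (e : E) (m : ℕ) :
    Integrable (visitCount Z e m) μ :=
  integrable_finsetSum _ fun j _ =>
    (integrable_const (1 : ℝ)).indicator (hZ j (measurableSet_singleton e))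

theorem visitCount_eq_of_hist_eq {Z : ℕ → Ω → E} {e : E} {m : ℕ} {ω ω' : Ω}
    (h : hist Z m ω = hist Z m ω') : visitCount Z e m ω = visitCount Z e m ω' := by
  refine Finset.sum_congr rfl fun j hj => ?_
  have := hist_eq_hist_iff.mp h j (Finset.mem_Icc.mp hj).2
  by_cases hj' : Z j ω' = e <;> simp [this, hj']

theorem measurable_hist [MeasurableSpace E] {Z : ℕ → Ω → E} (hZ : ∀ i, Measurable (Z i)) (i : ℕ) :
    Measurable (hist Z i) :=
  measurable_pi_lambda _ fun _ => hZ _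

variable [MeasurableSpace E] [MeasurableSingletonClass E]

theorem condAvg_visitCount {α : Type*} [MeasurableSpace α] [MeasurableSingletonClass α]
    {Z : ℕ → Ω → E} (hZ : ∀ i, Measurable (Z i)) (e : E) (m : ℕ) (H : Ω → α) (ω : Ω) :
    condAvg μ H (visitCount Z e m) ω =
      ∑ j ∈ Finset.Icc 1 m, (ProbabilityTheory.cond μ (H ⁻¹' {H ω})).real {ω | Z j ω = e} := by
  have hm : ∀ j, MeasurableSet {ω | Z j ω = e} := fun j => hZ j (measurableSet_singleton e)
  rw [condAvg]
  unfold visitCount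
  rw [integral_finsetSum _ fun j _ => (integrable_const (1 : ℝ)).indicator (hm j)]
  refine Finset.sum_congr rfl fun j _ => ?_
  rw [integral_indicator (hm j), setIntegral_const]
  simp

/-- Changing the value of the process at time `i ≥ 1`, for a fixed history before time `i`, changes the
expected number of visits to `e` by at most `‖Δ_m‖`: not at all before time `i`, by at most `1` at
time `i`, and by at most `η̄_{i,j}` at each time `j > i`. -/
theorem abs_condAvg_visitCount_sub_le [IsFiniteMeasure μ] {Z : ℕ → Ω → E}
    (hZ : ∀ i, Measurable (Z i)) (e : E) {m i : ℕ} (hi : 1 ≤ i) (him : i ≤ m) {ω₁ ω₂ : Ω}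
    (heq : ∀ p < i, Z p ω₁ = Z p ω₂) (h₁ : 0 < μ (hist Z i ⁻¹' {hist Z i ω₁}))
    (h₂ : 0 < μ (hist Z i ⁻¹' {hist Z i ω₂})) :
    |condAvg μ (hist Z i) (visitCount Z e m) ω₁ - condAvg μ (hist Z i) (visitCount Z e m) ω₂| ≤
      deltaNorm μ Z m := by
  have hm : ∀ j, MeasurableSet {ω | Z j ω = e} := fun j => hZ j (measurableSet_singleton e)
  have hh : (fun p : Fin i => Z p ω₂) = fun p : Fin i => Z p ω₁ :=
    funext fun p => (heq p p.isLt).symm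
  set ν₁ := ProbabilityTheory.cond μ (hist Z i ⁻¹' {hist Z i ω₁}) with hν₁
  set ν₂ := ProbabilityTheory.cond μ (hist Z i ⁻¹' {hist Z i ω₂}) with hν₂
  -- before time `i` the process is determined by the history
  have hbefore : ∀ j < i, ν₁.real {ω | Z j ω = e} = ν₂.real {ω | Z j ω = e} := by
    intro j hj
    have hdet : ∀ ω₀, Z j ω₀ = Z j ω₁ → 0 < μ (hist Z i ⁻¹' {hist Z i ω₀}) →
        (ProbabilityTheory.cond μ (hist Z i ⁻¹' {hist Z i ω₀})).real {ω | Z j ω = e} =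
          {ω | Z j ω = e}.indicator (fun _ => 1) ω₁ := by
      intro ω₀ hω₀ hpos
      have hcell : ∀ ω ∈ hist Z i ⁻¹' {hist Z i ω₀}, Z j ω = Z j ω₁ := fun ω hω =>
        (hist_eq_hist_iff.mp hω j hj.le).trans hω₀
      rw [measureReal_def, cond_apply' (hm j)]
      by_cases hZe : Z j ω₁ = e
      · have : hist Z i ⁻¹' {hist Z i ω₀} ∩ {ω | Z j ω = e} = hist Z i ⁻¹' {hist Z i ω₀} :=
          Set.inter_eq_left.mpr fun ω hω => (hcell ω hω).trans hZe
        rw [this, ENNReal.inv_mul_cancel hpos.ne' (measure_ne_top _ _)]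
        simp [hZe]
      · have : hist Z i ⁻¹' {hist Z i ω₀} ∩ {ω | Z j ω = e} = ∅ := by
          ext ω
          simp only [Set.mem_inter_iff, Set.mem_empty_iff_false, iff_false, not_and]
          intro hω hωe
          exact hZe ((hcell ω hω).symm.trans hωe)
        rw [this]
        simp [hZe]
    rw [hν₁, hν₂, hdet ω₁ rfl h₁, hdet ω₂ (heq j hj).symm h₂]
  have hafter : ∀ j, i < j → j ≤ m →
      |ν₁.real {ω | Z j ω = e} - ν₂.real {ω | Z j ω = e}| ≤ etaBar μ Z m i j := by
    intro j _ hjm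
    rw [preimage_hist_eq_historyEvent] at h₁ h₂ hν₁ hν₂
    rw [hh] at h₂ hν₂
    rw [hν₁, hν₂]
    exact abs_cond_sub_cond_le_etaBar Z hjm e _ _ _ h₁ h₂
  have hat : |ν₁.real {ω | Z i ω = e} - ν₂.real {ω | Z i ω = e}| ≤ 1 :=
    abs_sub_le_of_nonneg_of_le measureReal_nonneg measureReal_le_one measureReal_nonneg
      measureReal_le_one
  rw [condAvg_visitCount hZ, condAvg_visitCount hZ, ← Finset.sum_sub_distrib]
  have hsub : ∑ j ∈ Finset.Icc 1 m, (ν₁.real {ω | Z j ω = e} - ν₂.real {ω | Z j ω = e}) =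
      ∑ j ∈ Finset.Icc i m, (ν₁.real {ω | Z j ω = e} - ν₂.real {ω | Z j ω = e}) := by
    refine (Finset.sum_subset (Finset.Icc_subset_Icc_left hi) fun j hj hj' => ?_).symm
    rw [Finset.mem_Icc] at hj hj'
    rw [hbefore j (by omega), sub_self]
  rw [hsub, ← Finset.insert_Icc_add_one_left_eq_Icc him, Finset.sum_insert (by simp)]
  refine (abs_add_le _ _).trans (le_trans (add_le_add hat ?_) (sum_etaBar_le_deltaNorm μ Z hi him))
  refine (Finset.abs_sum_le_sum_abs _ _).trans (Finset.sum_le_sum fun j hj => ?_)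
  rw [Finset.mem_Icc] at hj
  exact hafter j (by omega) hj.2

/-- The Doob martingale differences of the number of visits to `e`, scaled by `D`. -/
noncomputable def visitDiff (μ : Measure Ω) (Z : ℕ → Ω → E) (e : E) (m : ℕ) (D : ℝ) (i : ℕ)
    (ω : Ω) : ℝ :=
  (condAvg μ (hist Z (i + 1)) (visitCount Z e m) ω - condAvg μ (hist Z i) (visitCount Z e m) ω) / D

theorem condAvg_hist_visitCount [IsFiniteMeasure μ] [Finite E] {Z : ℕ → Ω → E}
    (hZ : ∀ i, Measurable (Z i)) (e : E) (m : ℕ) :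
    ∀ᵐ ω ∂μ, condAvg μ (hist Z m) (visitCount Z e m) ω = visitCount Z e m ω := by
  filter_upwards [ae_pos_fiber (measurable_hist hZ m)] with ω hω
  have h1 := measureReal_mul_condAvg (μ := μ) (hist Z m) (visitCount Z e m) ω
  rw [setIntegral_congr_fun (measurable_hist hZ m (measurableSet_singleton _))
    (g := fun _ => visitCount Z e m ω) (fun ω' hω' => visitCount_eq_of_hist_eq hω'),
    setIntegral_const, smul_eq_mul] at h1
  exact mul_left_cancel₀ (ENNReal.toReal_pos hω.ne' (measure_ne_top _ _)).ne' h1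

theorem abs_visitDiff_le [IsFiniteMeasure μ] [Finite E] {Z : ℕ → Ω → E}
    (hZ : ∀ i, Measurable (Z i)) (e : E) {m : ℕ} {D : ℝ} (hD0 : 0 < D) (hD : deltaNorm μ Z m ≤ D)
    {i : ℕ} (hi : i < m) : ∀ᵐ ω ∂μ, |visitDiff μ Z e m D i ω| ≤ 1 := by
  have h := abs_condAvg_sub_condAvg_comp_le (measurable_hist hZ (i + 1))
    (integrable_visitCount (μ := μ) hZ e m)
    (fun (w : Fin (i + 1 + 1) → E) (p : Fin (i + 1)) => w p.castSucc) D ?_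
  · filter_upwards [h] with ω hω
    rw [visitDiff, abs_div, abs_of_pos hD0, div_le_one hD0]
    exact hω
  · intro ω₁ ω₂ hω h₁ h₂
    refine (abs_condAvg_visitCount_sub_le hZ e (by omega) hi (fun p hp => ?_) h₁ h₂).trans hD
    exact congrFun hω ⟨p, hp⟩

theorem integral_expWeight_mul_visitDiff [IsFiniteMeasure μ] [Finite E] {Z : ℕ → Ω → E}
    (hZ : ∀ i, Measurable (Z i)) (e : E) (m : ℕ) (D r : ℝ) (k : ℕ) :
    ∫ ω, expWeight (visitDiff μ Z e m D) (fun _ _ => 1) r k ω * visitDiff μ Z e m D k ω ∂μ = 0 := by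
  have hf := integrable_visitCount (μ := μ) hZ e m
  have hfac : Function.FactorsThrough (expWeight (visitDiff μ Z e m D) (fun _ _ => 1) r k)
      (hist Z k) := by
    intro ω ω' h
    rw [expWeight, expWeight]
    congr 1
    refine Finset.sum_congr rfl fun i hi => ?_
    have h' := hist_eq_hist_iff.mp h
    have hik := Finset.mem_range.mp hi
    rw [visitDiff, visitDiff,
      condAvg_congr (H := hist Z (i + 1)) (hist_eq_hist_iff.mpr fun p hp => h' p (by omega)),
      condAvg_congr (H := hist Z i) (hist_eq_hist_iff.mpr fun p hp => h' p (by omega))]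
  obtain ⟨φ, hφ⟩ := (Function.factorsThrough_iff _).mp hfac
  have h1 := integral_comp_mul_condAvg (measurable_hist hZ k) hf φ
  have h2 := integral_comp_mul_condAvg (measurable_hist hZ (k + 1)) hf
    (fun w => φ fun p : Fin (k + 1) => w p.castSucc)
  have hint : ∀ j, Integrable (condAvg μ (hist Z j) (visitCount Z e m)) μ := fun j => by
    obtain ⟨ψ, hψ⟩ := condAvg_factors μ (hist Z j) (visitCount Z e m)
    rw [funext hψ]
    exact integrable_comp_of_finite (measurable_hist hZ j) ψ
  have h3 : ∀ ω, expWeight (visitDiff μ Z e m D) (fun _ _ => 1) r k ω * visitDiff μ Z e m D k ω =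
      (φ (hist Z k ω) * condAvg μ (hist Z (k + 1)) (visitCount Z e m) ω -
        φ (hist Z k ω) * condAvg μ (hist Z k) (visitCount Z e m) ω) / D := by
    intro ω
    rw [hφ, visitDiff, Function.comp_apply]
    ring
  simp_rw [h3]
  rw [integral_div, integral_sub (integrable_comp_mul (measurable_hist hZ k) φ (hint _))
    (integrable_comp_mul (measurable_hist hZ k) φ (hint _)), h1]
  have h4 : ∫ ω, φ (hist Z k ω) * condAvg μ (hist Z (k + 1)) (visitCount Z e m) ω ∂μ =
      ∫ ω, φ (hist Z k ω) * visitCount Z e m ω ∂μ := h2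
  rw [h4, sub_self, zero_div]

/-- Concentration of the number of visits around its conditional expectation given the value at
time `0`. The mixing condition does not restrict the influence of that value. -/
theorem measureReal_visitCount_lt_le [IsProbabilityMeasure μ] [Finite E] {Z : ℕ → Ω → E}
    (hZ : ∀ i, Measurable (Z i)) (e : E) {m : ℕ} (hm : 0 < m) {D q : ℝ} (hD0 : 0 < D)
    (hD : deltaNorm μ Z m ≤ D) (hq : 0 ≤ q)
    (hmean : ∀ᵐ ω ∂μ, 2 * q ≤ condAvg μ (hist Z 0) (visitCount Z e m) ω) :
    μ.real {ω | visitCount Z e m ω < q} ≤ Real.exp (-(q ^ 2 / (2 * D ^ 2 * m))) := by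
  have hm' : (0 : ℝ) < m := by exact_mod_cast hm
  set V := visitDiff μ Z e m D with hVdef
  set r : ℝ := -(q / (D * m)) with hr
  have hVm : ∀ i, Measurable (V i) := fun i =>
    ((measurable_condAvg (measurable_hist hZ _) _).sub
      (measurable_condAvg (measurable_hist hZ _) _)).div_const D
  have h := measureReal_le_exp_neg hVm (Y := fun _ _ => 1) (fun _ => measurable_const) m
    (fun i hi => by
      filter_upwards [abs_visitDiff_le hZ e hD0 hD hi] with ω hω
      exact ⟨hω, Or.inr rfl⟩) r
    (fun k _ => integral_expWeight_mul_visitDiff hZ e m D r k) (q ^ 2 / (2 * D ^ 2 * m))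
  refine le_trans (ENNReal.toReal_mono (measure_ne_top _ _) (measure_mono_ae ?_)) h
  filter_upwards [hmean, condAvg_hist_visitCount hZ e m] with ω h1 h2 (h3 : visitCount Z e m ω < q)
  change q ^ 2 / (2 * D ^ 2 * m) ≤ ∑ i ∈ Finset.range m, (r * V i ω - r ^ 2 / 2 * 1)
  have htel : ∑ i ∈ Finset.range m, V i ω =
      (visitCount Z e m ω - condAvg μ (hist Z 0) (visitCount Z e m) ω) / D := by
    simp only [hVdef, visitDiff]
    rw [← Finset.sum_div, Finset.sum_range_sub
      (fun i => condAvg μ (hist Z i) (visitCount Z e m) ω), h2]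
  rw [Finset.sum_sub_distrib, ← Finset.mul_sum, htel]
  have h4 : (visitCount Z e m ω - condAvg μ (hist Z 0) (visitCount Z e m) ω) / D ≤ -q / D := by
    gcongr
    linarith
  have h5 : r ≤ 0 := by
    rw [hr]
    exact neg_nonpos.mpr (by positivity)
  have h6 := mul_le_mul_of_nonpos_left h4 h5
  have h7 : r * (-q / D) - m * (r ^ 2 / 2) = q ^ 2 / (2 * D ^ 2 * m) := by
    rw [hr]
    field_simp
    ring
  simp only [mul_one, Finset.sum_const, Finset.card_range, nsmul_eq_mul]
  linarith

end Visits

/-! ### The expected number of visits under the return time condition -/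

section ReturnTimes

variable {Ω E : Type*} {mΩ : MeasurableSpace Ω} {μ : Measure Ω}

theorem natCast_le_visitCount_of_visitTime_eq {Z : ℕ → Ω → E} {e : E} {n k : ℕ} {ω : Ω}
    (h : visitTime Z e n ω = k) : (n : ℝ) ≤ visitCount Z e k ω := by
  have hnn : ∀ j, 0 ≤ {ω | Z j ω = e}.indicator (fun _ => (1 : ℝ)) ω := fun j =>
    Set.indicator_nonneg (fun _ _ => zero_le_one) ω
  induction n generalizing k with
  | zero =>
    rw [Nat.cast_zero]
    exact Finset.sum_nonneg fun j _ => hnn j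
  | succ n ih =>
    obtain ⟨k', hk', h1, h2, -⟩ := (visitTime_succ_eq_coe_iff Z e n k ω).mp h
    have h3 : visitCount Z e k' ω + 1 ≤ visitCount Z e k ω := by
      have hsub : insert k (Finset.Icc 1 k') ⊆ Finset.Icc 1 k := by
        intro j
        simp only [Finset.mem_insert, Finset.mem_Icc]
        omega
      refine le_trans (le_of_eq ?_)
        (Finset.sum_le_sum_of_subset_of_nonneg hsub fun j _ _ => hnn j)
      rw [Finset.sum_insert (by simp; omega), visitCount, add_comm]
      simp [h2]
    push_cast
    linarith [ih h1]

theorem natCast_le_visitCount {Z : ℕ → Ω → E} {e : E} {n m : ℕ} {ω : Ω}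
    (h : visitTime Z e n ω ≤ m) : (n : ℝ) ≤ visitCount Z e m ω := by
  obtain ⟨k, hk⟩ := ENat.ne_top_iff_exists.mp (ne_top_of_le_ne_top (ENat.natCast_ne_top m) h)
  rw [← hk] at h
  have hkm : k ≤ m := by exact_mod_cast h
  refine (natCast_le_visitCount_of_visitTime_eq hk.symm).trans ?_
  exact Finset.sum_le_sum_of_subset_of_nonneg (Finset.Icc_subset_Icc_right hkm)
    fun j _ _ => Set.indicator_nonneg (fun _ _ => zero_le_one) ω

variable [MeasurableSpace E] [MeasurableSingletonClass E] {F : Filtration ℕ mΩ} {Z : ℕ → Ω → E}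

theorem measurable_visitTime (hZ : Adapted F Z) (e : E) (n : ℕ) : Measurable (visitTime Z e n) :=
  measurable_to_countable' fun x => by
    cases x with
    | top =>
      have h : visitTime Z e n ⁻¹' {⊤} = (⋃ k : ℕ, {ω | visitTime Z e n ω = k})ᶜ := by
        ext ω
        simp only [Set.mem_preimage, Set.mem_singleton_iff, Set.mem_compl_iff, Set.mem_iUnion,
          not_exists]
        constructor
        · intro hω k (hk : visitTime Z e n ω = k)
          rw [hω] at hk
          exact ENat.natCast_ne_top k hk.symm
        · intro hω
          by_contra hne
          obtain ⟨k, hk⟩ := ENat.ne_top_iff_exists.mp hne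
          exact hω k hk.symm
      rw [h]
      exact (MeasurableSet.iUnion fun k =>
        F.le k _ ((isStoppingTime_visitTime hZ e n).measurableSet_eq k)).compl
    | coe k => exact F.le k _ ((isStoppingTime_visitTime hZ e n).measurableSet_eq k)

/-- The `n`-th visit to `e` takes an expected time of at most `n T` on every event that is known at
time `0`. -/
theorem setLIntegral_visitTime_le [IsFiniteMeasure μ] {hZ : Adapted F Z} {T : ℕ}
    (hT : ReturnTimeCondition μ hZ T) (e : E) {A : Set Ω} (hA : MeasurableSet[F 0] A) (n : ℕ) :
    ∫⁻ ω in A, (visitTime Z e n ω : ℝ≥0∞) ∂μ ≤ n * T * μ A := by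
  induction n with
  | zero => simp [visitTime]
  | succ n ih =>
    have hτ := isStoppingTime_visitTime hZ e n
    have hA' : MeasurableSet[hτ.measurableSpace] A :=
      hτ.le_measurableSpace_of_const_le (i := 0) (fun _ => zero_le) A hA
    have hret : ∫⁻ ω in A, (returnTime Z e (n + 1) ω : ℝ≥0∞) ∂μ ≤ T * μ A := by
      rw [← setLIntegral_condLExp hτ.measurableSpace_le μ _ hA', ← setLIntegral_const]
      refine setLIntegral_mono_ae measurable_const.aemeasurable ?_
      filter_upwards [hT] with ω hω _
      exact (le_iSup₂ (f := fun (e : E) (i : ℕ) =>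
        condLExp (isStoppingTime_visitTime hZ e i).measurableSpace μ
          (fun ω' => (returnTime Z e (i + 1) ω' : ℝ≥0∞)) ω) e n).trans hω.le
    have hsum : ∀ ω, (visitTime Z e (n + 1) ω : ℝ≥0∞) =
        (visitTime Z e n ω : ℝ≥0∞) + (returnTime Z e (n + 1) ω : ℝ≥0∞) := fun ω => by
      rw [← ENat.toENNReal_add]
      rfl
    simp_rw [hsum]
    have hmeas : Measurable fun ω => (visitTime Z e n ω : ℝ≥0∞) :=
      (Measurable.of_discrete (f := ENat.toENNReal)).comp (measurable_visitTime hZ e n)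
    rw [lintegral_add_left hmeas]
    calc _ ≤ n * T * μ A + T * μ A := add_le_add ih hret
      _ = ((n + 1 : ℕ) : ℝ≥0∞) * T * μ A := by
        push_cast
        ring

/-- The first `m` steps are expected to contain at least `n / 2` visits to `e` if `2 n T ≤ m`, whatever
the value at time `0`: by Markov's inequality the `n`-th visit occurs by time `m` with conditional
probability at least `1 / 2`. -/
theorem half_le_condAvg_visitCount [IsFiniteMeasure μ] [Finite E] {hZ : Adapted F Z} {T : ℕ}
    (hT : ReturnTimeCondition μ hZ T) (e : E) {n m : ℕ} (hm : 0 < m) (hnm : 2 * (n * T) ≤ m) :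
    ∀ᵐ ω ∂μ, 2 * ((n : ℝ) / 4) ≤ condAvg μ (hist Z 0) (visitCount Z e m) ω := by
  have hZm : ∀ i, Measurable (Z i) := fun i => (hZ i).mono (F.le i) le_rfl
  have hm' : (0 : ℝ) < m := by exact_mod_cast hm
  filter_upwards [ae_pos_fiber (measurable_hist hZm 0)] with ω hω
  set A := hist Z 0 ⁻¹' {hist Z 0 ω} with hAdef
  have hA0 : MeasurableSet[F 0] A := by
    have : A = {ω' | Z 0 ω' = Z 0 ω} := by
      ext ω'
      change hist Z 0 ω' = hist Z 0 ω ↔ _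
      rw [hist_eq_hist_iff]
      simp
    rw [this]
    exact hZ 0 (measurableSet_singleton _)
  have hA : MeasurableSet A := F.le 0 _ hA0
  have hApos : 0 < μ.real A := ENNReal.toReal_pos hω.ne' (measure_ne_top _ _)
  set G : Set Ω := {ω' | visitTime Z e n ω' ≤ m} with hG
  have hGm : MeasurableSet G := measurable_visitTime hZ e n (MeasurableSet.of_discrete (s := Set.Iic _))
  have hlate : (m : ℝ) * μ.real (A \ G) ≤ n * T * μ.real A := by
    have h1 : (m : ℝ≥0∞) * μ (A \ G) ≤ n * T * μ A := by
      refine le_trans ?_ (setLIntegral_visitTime_le hT e hA0 n)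
      refine le_trans ?_ (lintegral_mono_set (Set.sdiff_subset : A \ G ⊆ A))
      rw [← setLIntegral_const]
      refine setLIntegral_mono' (hA.diff hGm) fun ω' hω' => ?_
      have h2 : (m : ℕ∞) ≤ visitTime Z e n ω' := (not_le.mp hω'.2).le
      exact_mod_cast ENat.toENNReal_le.mpr h2
    have h2 := ENNReal.toReal_mono (ENNReal.mul_ne_top (by finiteness) (measure_ne_top _ _)) h1
    simpa [ENNReal.toReal_mul, measureReal_def] using h2
  have hsplit : μ.real (A ∩ G) + μ.real (A \ G) = μ.real A := measureReal_inter_add_sdiff hGm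
  have hnT : 2 * ((n : ℝ) * T) ≤ m := by exact_mod_cast hnm
  have hearly : μ.real A ≤ 2 * μ.real (A ∩ G) := by
    have h1 : (m : ℝ) * (2 * μ.real (A \ G)) ≤ m * μ.real A := by
      nlinarith
    have h2 := le_of_mul_le_mul_left h1 hm'
    linarith
  have hint := integrable_visitCount (μ := μ) hZm e m
  have hmean : (n : ℝ) * μ.real (A ∩ G) ≤ μ.real A * condAvg μ (hist Z 0) (visitCount Z e m) ω := by
    rw [measureReal_mul_condAvg]
    calc (n : ℝ) * μ.real (A ∩ G) = ∫ _ in A ∩ G, (n : ℝ) ∂μ := by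
          rw [setIntegral_const, smul_eq_mul, mul_comm]
      _ ≤ ∫ ω' in A ∩ G, visitCount Z e m ω' ∂μ :=
          setIntegral_mono_on (integrable_const _).integrableOn hint.integrableOn (hA.inter hGm)
            fun ω' hω' => natCast_le_visitCount hω'.2
      _ ≤ ∫ ω' in A, visitCount Z e m ω' ∂μ :=
          setIntegral_mono_set hint.integrableOn (Filter.Eventually.of_forall fun ω' =>
            Finset.sum_nonneg fun j _ => Set.indicator_nonneg (fun _ _ => zero_le_one) ω')
            (Filter.Eventually.of_forall Set.inter_subset_left)
  have h1 : μ.real A * (2 * ((n : ℝ) / 4)) ≤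
      μ.real A * condAvg μ (hist Z 0) (visitCount Z e m) ω := by
    refine le_trans ?_ hmean
    have := mul_le_mul_of_nonneg_left hearly (Nat.cast_nonneg (α := ℝ) n)
    linarith
  exact le_of_mul_le_mul_left h1 hApos

end ReturnTimes

/-! ### The estimator -/

section Estimator

variable {Ω χ I : Type*}

theorem transitions_le_visits (X : ℕ → Ω → χ) (a : ℕ → Ω → I) (m : ℕ) (l : I) (s t : χ) (ω : Ω) :
    transitions X a m l s t ω ≤ visits X a m l s ω := by
  refine Finset.sum_le_sum fun i _ => ?_
  by_cases h1 : X i ω = s <;> by_cases h2 : X (i + 1) ω = t <;> by_cases h3 : a i ω = l <;>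
    simp [h1, h2, h3]

theorem estimator_mem (X : ℕ → Ω → χ) (a : ℕ → Ω → I) (m : ℕ) (l : I) (s t : χ) (ω : Ω) :
    0 ≤ estimator X a m l ω s t ∧ estimator X a m l ω s t ≤ 1 := by
  rw [estimator, Matrix.of_apply]
  exact ⟨by positivity,
    div_le_one_of_le₀ (by exact_mod_cast transitions_le_visits X a m l s t ω) (Nat.cast_nonneg _)⟩

theorem visitCount_pair (X : ℕ → Ω → χ) (a : ℕ → Ω → I) (m : ℕ) (l : I) (s : χ) (ω : Ω) :
    visitCount (pair X a) (s, l) m ω = visits X a m l s ω := by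
  rw [visits, visitCount]
  push_cast
  refine Finset.sum_congr rfl fun i _ => ?_
  by_cases h1 : X i ω = s <;> by_cases h2 : a i ω = l <;> simp [pair, h1, h2]

/-- A large entry of the error comes from a pair `(s, l)` with few visits, or from a deviation of a
transition count that is large relative to the number of visits. -/
theorem exists_of_lt_iSup_entryNorm {X : ℕ → Ω → χ} {a : ℕ → Ω → I} {M : I → Matrix χ χ ℝ} {m : ℕ}
    {ε q : ℝ} (hε : 0 ≤ ε) (hq : 0 < q) {ω : Ω}
    (h : ε < ⨆ l : I, entryNorm (estimator X a m l ω - M l)) :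
    (∃ p : χ × I, (visits X a m p.2 p.1 ω : ℝ) < q) ∨
      ∃ p : (χ × I) × χ, q ≤ visits X a m p.1.2 p.1.1 ω ∧ ε * visits X a m p.1.2 p.1.1 ω <
        |(transitions X a m p.1.2 p.1.1 p.2 ω : ℝ) -
          M p.1.2 p.1.1 p.2 * visits X a m p.1.2 p.1.1 ω| := by
  by_contra! hcon
  obtain ⟨h1, h2⟩ := hcon
  refine absurd h (not_lt.mpr (Real.iSup_le (fun l => Real.iSup_le ?_ hε) hε))
  rintro ⟨s, t⟩
  have hN := h1 (s, l)
  have hN0 : (0 : ℝ) < visits X a m l s ω := hq.trans_le hN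
  have hd := h2 ((s, l), t) hN
  have heq : (transitions X a m l s t ω : ℝ) / visits X a m l s ω - M l s t =
      ((transitions X a m l s t ω : ℝ) - M l s t * visits X a m l s ω) / visits X a m l s ω := by
    field_simp
  rw [Matrix.sub_apply, estimator, Matrix.of_apply, heq, abs_div, abs_of_pos hN0, div_le_iff₀ hN0]
  exact hd

theorem two_le_card_of_setsCondition {E : Type*} [Fintype E] {mΩ : MeasurableSpace Ω}
    {μ : Measure Ω} [IsProbabilityMeasure μ] {Z : ℕ → Ω → E} {ζ₁ ζ₂ : ℝ}
    (h : SetsCondition μ Z ζ₁ ζ₂) : 2 ≤ Fintype.card E := by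
  obtain ⟨h1, h2, h3⟩ := h
  obtain ⟨S, hS1, hS2⟩ := h3 0
  by_contra! hcard
  have : Subsingleton E := Fintype.card_le_one_iff_subsingleton.mp (by omega)
  rcases S.eq_empty_or_nonempty with rfl | hne
  · simp at hS1
    linarith
  · rw [Subsingleton.eq_univ_of_nonempty hne] at hS2
    simp at hS2
    linarith

variable [mΩ : MeasurableSpace Ω] [Fintype χ] [DecidableEq χ] [MeasurableSpace χ]
  [MeasurableSingletonClass χ] [Fintype I] [MeasurableSpace I] [MeasurableSingletonClass I]
  {μ : Measure Ω} [IsProbabilityMeasure μ] {F : Filtration ℕ mΩ}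
  {X : ℕ → Ω → χ} {a : ℕ → Ω → I} {M : I → Matrix χ χ ℝ}

/-- The explicit error probability: a union bound over the pairs `(s, l)` and the triples
`(s, l, t)`, with the threshold `n / 4` for the number of visits. -/
theorem measureReal_error_le (hchain : IsControlledMarkovChain μ F X a M) {T : ℕ} {C : ℝ}
    (hT : ReturnTimeCondition μ hchain.adapted T) (hC : MixingCondition μ (pair X a) C)
    {ε : ℝ} (hε : 0 < ε) {n m : ℕ} (hn : 0 < n) (hm : 0 < m) (hnm : 2 * (n * T) ≤ m) :
    μ.real {ω | ε < ⨆ l : I, entryNorm (estimator X a m l ω - M l)} ≤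
      Fintype.card (χ × I) * Real.exp (-(((n : ℝ) / 4) ^ 2 / (2 * C ^ 2 * m))) +
      Fintype.card ((χ × I) × χ) * (2 * Real.exp (-(ε ^ 2 / 2 * ((n : ℝ) / 4)))) := by
  have hn' : (0 : ℝ) < n := by exact_mod_cast hn
  have hZ : ∀ i, Measurable (pair X a i) := fun i => (hchain.adapted i).mono (F.le i) le_rfl
  set B₁ : χ × I → Set Ω := fun p => {ω | (visits X a m p.2 p.1 ω : ℝ) < (n : ℝ) / 4} with hB₁
  set B₂ : (χ × I) × χ → Set Ω := fun p => {ω | (n : ℝ) / 4 ≤ visits X a m p.1.2 p.1.1 ω ∧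
    ε * visits X a m p.1.2 p.1.1 ω < |(transitions X a m p.1.2 p.1.1 p.2 ω : ℝ) -
      M p.1.2 p.1.1 p.2 * visits X a m p.1.2 p.1.1 ω|} with hB₂
  have hsub : {ω | ε < ⨆ l : I, entryNorm (estimator X a m l ω - M l)} ⊆
      (⋃ p, B₁ p) ∪ ⋃ p, B₂ p := by
    intro ω hω
    rcases exists_of_lt_iSup_entryNorm hε.le (by positivity : (0 : ℝ) < n / 4) hω with
      ⟨p, hp⟩ | ⟨p, hp⟩
    · exact Or.inl (Set.mem_iUnion.mpr ⟨p, hp⟩)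
    · exact Or.inr (Set.mem_iUnion.mpr ⟨p, hp⟩)
  refine (measureReal_mono hsub (measure_ne_top _ _)).trans
    ((measureReal_union_le _ _).trans (add_le_add ?_ ?_))
  · refine (measureReal_iUnion_fintype_le _).trans ?_
    rw [← nsmul_eq_mul, ← Finset.card_univ]
    refine Finset.sum_le_card_nsmul _ _ _ fun p _ => ?_
    have h := measureReal_visitCount_lt_le hZ p hm (zero_lt_one.trans hC.1) (hC.2 m hm)
      (by positivity : (0 : ℝ) ≤ n / 4) (half_le_condAvg_visitCount hT p hm hnm)
    simpa only [hB₁, ← visitCount_pair] using h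
  · refine (measureReal_iUnion_fintype_le _).trans ?_
    rw [← nsmul_eq_mul, ← Finset.card_univ]
    exact Finset.sum_le_card_nsmul _ _ _ fun p _ =>
      measureReal_transition_deviation_le hchain p.1.2 p.1.1 p.2 m hε _

end Estimator

/-! ### The sample size -/

/-- An error probability `exp (-b)` with `b ≥ 4 log (N / δ)` is at most `(δ / N) ^ 4`. -/
theorem exp_neg_le_div_pow {N δ b : ℝ} (hN : 0 < N) (hδ : 0 < δ) (hb : 4 * Real.log (N / δ) ≤ b) :
    Real.exp (-b) ≤ (δ / N) ^ 4 := by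
  calc Real.exp (-b) ≤ Real.exp (-(4 * Real.log (N / δ))) := Real.exp_le_exp.mpr (by linarith)
    _ = (Real.exp (-Real.log (N / δ))) ^ 4 := by
      rw [← Real.exp_nat_mul]
      push_cast
      ring_nf
    _ = (δ / N) ^ 4 := by
      rw [Real.exp_neg, Real.exp_log (by positivity), inv_div]

/-- The union bound over at most `N` pairs and at most `N ^ 2` triples. -/
theorem union_bound_lt {N N₂ δ b₁ b₂ : ℝ} (hN : 2 ≤ N) (hN₂ : N₂ ≤ N ^ 2) (hδ : 0 < δ) (hδ1 : δ < 1)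
    (hb₁ : 4 * Real.log (N / δ) ≤ b₁) (hb₂ : 4 * Real.log (N / δ) ≤ b₂) :
    N * Real.exp (-b₁) + N₂ * (2 * Real.exp (-b₂)) < δ := by
  have hN0 : 0 < N := by linarith
  have h1 := exp_neg_le_div_pow hN0 hδ hb₁
  have h2 := exp_neg_le_div_pow hN0 hδ hb₂
  have hδ4 : δ ^ 4 ≤ δ := by
    calc δ ^ 4 ≤ δ ^ 1 := pow_le_pow_of_le_one hδ.le hδ1.le (by norm_num)
      _ = δ := pow_one δ
  have e1 : N * (δ / N) ^ 4 ≤ δ / 8 := by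
    have : N * (δ / N) ^ 4 = δ ^ 4 / N ^ 3 := by field_simp
    rw [this]
    have : (8 : ℝ) ≤ N ^ 3 := by
      calc (8 : ℝ) = 2 ^ 3 := by norm_num
        _ ≤ N ^ 3 := by gcongr
    gcongr
  have e2 : N ^ 2 * (2 * (δ / N) ^ 4) ≤ δ / 2 := by
    have : N ^ 2 * (2 * (δ / N) ^ 4) = 2 * δ ^ 4 / N ^ 2 := by field_simp
    rw [this]
    have h4 : (4 : ℝ) ≤ N ^ 2 := by
      calc (4 : ℝ) = 2 ^ 2 := by norm_num
        _ ≤ N ^ 2 := by gcongr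
    calc 2 * δ ^ 4 / N ^ 2 ≤ 2 * δ / 4 := by gcongr
      _ = δ / 2 := by ring
  calc N * Real.exp (-b₁) + N₂ * (2 * Real.exp (-b₂))
      ≤ N * (δ / N) ^ 4 + N ^ 2 * (2 * (δ / N) ^ 4) := by gcongr
    _ ≤ δ / 8 + δ / 2 := add_le_add e1 e2
    _ < δ := by linarith

end ControlledChain

theorem mainTheorem2 :
    ∃ c : ℝ, 1 < c ∧
      ∀ {Ω χ I : Type*} [mΩ : MeasurableSpace Ω] [Fintype χ] [DecidableEq χ] [MeasurableSpace χ]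
        [MeasurableSingletonClass χ] [Fintype I] [MeasurableSpace I] [MeasurableSingletonClass I]
        (μ : Measure Ω) [IsProbabilityMeasure μ] (F : Filtration ℕ mΩ)
        (X : ℕ → Ω → χ) (a : ℕ → Ω → I) (M : I → Matrix χ χ ℝ)
        (hchain : ControlledChain.IsControlledMarkovChain μ F X a M)
        (ζ₁ ζ₂ : ℝ) (T : ℕ) (CΔ : ℝ),
        ControlledChain.SetsCondition μ (ControlledChain.pair X a) ζ₁ ζ₂ →
        0 < T →
        ControlledChain.ReturnTimeCondition μ hchain.adapted T →
        ControlledChain.MixingCondition μ (ControlledChain.pair X a) CΔ →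
        ∀ (ε δ : ℝ) (m : ℕ), 0 < ε → 0 < δ → δ < 1 →
          (m : ℝ) > c * max
            ((T : ℝ) / ε ^ 2 *
              Real.log ((Fintype.card χ : ℝ) * (Fintype.card I : ℝ) * (T : ℝ) / (ε ^ 2 * δ)))
            (CΔ ^ 2 * max ((T : ℝ) ^ 2) (1 / (1 - max ζ₁ (1 - ζ₂)) ^ 2) *
              Real.log ((Fintype.card χ : ℝ) * (Fintype.card I : ℝ) / δ)) →
          μ.real {ω | ε < ⨆ l : I,
            ControlledChain.entryNorm (ControlledChain.estimator X a m l ω - M l)} < δ := by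
  -- with `n ≥ m / (4 T)` visits the two exponents are at least `m / (512 C² T²)` and `ε² m / (32 T)`;
  -- the constant makes both of them at least `4 log (d k / δ)`
  refine ⟨2048, by norm_num, ?_⟩
  intro Ω χ I mΩ _ _ _ _ _ _ _ μ _ F X a M hchain ζ₁ ζ₂ T CΔ hsets hT hret hmix ε δ m hε hδ hδ1 hm
  -- the entries of both matrices lie in `[0, 1]`
  rcases le_or_gt 1 ε with hε1 | hε1
  · have hempty : {ω | ε < ⨆ l : I,
        ControlledChain.entryNorm (ControlledChain.estimator X a m l ω - M l)} = ∅ := by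
      refine Set.eq_empty_of_forall_notMem fun ω (hω : ε < _) => absurd hω (not_lt.mpr ?_)
      refine (Real.iSup_le (fun l => Real.iSup_le (fun p => ?_) zero_le_one) zero_le_one).trans hε1
      have h1 := ControlledChain.estimator_mem X a m l p.1 p.2 ω
      have h2 := hchain.entry_mem l p.1 p.2
      exact abs_sub_le_of_nonneg_of_le h1.1 h1.2 h2.1 h2.2
    rw [hempty]
    simpa using hδ
  have hcard := ControlledChain.two_le_card_of_setsCondition hsets
  set N : ℝ := (Fintype.card χ : ℝ) * (Fintype.card I : ℝ) with hNdef
  have hNcard : (Fintype.card (χ × I) : ℝ) = N := by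
    rw [Fintype.card_prod, Nat.cast_mul]
  have hN : 2 ≤ N := by
    rw [← hNcard]
    exact_mod_cast hcard
  have hN₂ : (Fintype.card ((χ × I) × χ) : ℝ) ≤ N ^ 2 := by
    rw [Fintype.card_prod, Nat.cast_mul, hNcard, sq]
    have hI : Fintype.card I ≠ 0 := by
      intro h
      rw [hNdef, h] at hN
      norm_num at hN
    have hI1 : (1 : ℝ) ≤ Fintype.card I := by exact_mod_cast Nat.one_le_iff_ne_zero.mpr hI
    have : (Fintype.card χ : ℝ) ≤ N := le_mul_of_one_le_right (Nat.cast_nonneg _) hI1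
    gcongr
  have hT1 : (1 : ℝ) ≤ T := by exact_mod_cast hT
  have hC1 : 1 < CΔ := hmix.1
  set L := Real.log (N / δ) with hL
  have hNδ : 2 ≤ N / δ := by
    rw [le_div_iff₀ hδ]
    nlinarith
  have hLlow : 1 / 2 ≤ L := by
    have h1 := Real.log_two_gt_d9
    have h2 := Real.log_le_log (by norm_num) hNδ
    linarith
  have hL' : L ≤ Real.log (N * T / (ε ^ 2 * δ)) := by
    refine Real.log_le_log (by positivity) ?_
    have h1 : ε ^ 2 ≤ 1 := pow_le_one₀ hε.le hε1.le
    have h2 : N ≤ N * T := le_mul_of_one_le_right (by linarith) hT1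
    gcongr
    exact mul_le_of_le_one_left hδ.le h1
  have hm1 : 2048 * (T / ε ^ 2 * L) < m := by
    refine lt_of_le_of_lt ?_ hm
    refine mul_le_mul_of_nonneg_left (le_max_of_le_left ?_) (by norm_num)
    gcongr
  have hm2 : 2048 * (CΔ ^ 2 * (T : ℝ) ^ 2 * L) < m := by
    refine lt_of_le_of_lt ?_ hm
    refine mul_le_mul_of_nonneg_left (le_max_of_le_right ?_) (by norm_num)
    gcongr
    exact le_max_left _ _
  have hmT : 2 * (T : ℝ) ≤ m := by
    have h1 : (1 : ℝ) ≤ CΔ ^ 2 := one_le_pow₀ hC1.le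
    have h2 : (T : ℝ) ≤ (T : ℝ) ^ 2 := by nlinarith
    have h3 : 1 * (T : ℝ) ≤ CΔ ^ 2 * (T : ℝ) ^ 2 := by gcongr
    have h4 : 1 * (T : ℝ) * (1 / 2) ≤ CΔ ^ 2 * (T : ℝ) ^ 2 * L := by gcongr
    linarith
  have hmTnat : 2 * T ≤ m := by exact_mod_cast hmT
  have hm0 : 0 < m := by omega
  have hm0' : (0 : ℝ) < m := by exact_mod_cast hm0
  set n := m / (2 * T) with hn
  have hn0 : 0 < n := Nat.div_pos hmTnat (by omega)
  have hnm : 2 * (n * T) ≤ m := by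
    have := Nat.div_mul_le_self m (2 * T)
    rw [← hn] at this
    linarith
  -- rounding down costs at most a factor of two because `n ≥ 1`
  have hnlow : (m : ℝ) ≤ 4 * T * n := by
    have h1 : m < 2 * T * (n + 1) := Nat.lt_mul_div_succ m (by omega)
    have h2 : 2 * T * (n + 1) ≤ 4 * T * n := by nlinarith
    exact_mod_cast (h1.trans_le h2).le
  have hbound := ControlledChain.measureReal_error_le hchain hret hmix hε hn0 hm0 hnm
  rw [hNcard] at hbound
  refine hbound.trans_lt (ControlledChain.union_bound_lt hN hN₂ hδ hδ1 ?_ ?_)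
  · rw [le_div_iff₀ (by positivity)]
    have h1 : (m : ℝ) ^ 2 ≤ (4 * T * n) ^ 2 := by gcongr
    have h2 : 2048 * (CΔ ^ 2 * (T : ℝ) ^ 2 * L) * m ≤ m ^ 2 := by
      rw [sq (m : ℝ)]
      gcongr
    have h3 : (T : ℝ) ^ 2 * (128 * (CΔ ^ 2 * L * m)) ≤ (T : ℝ) ^ 2 * (n : ℝ) ^ 2 := by nlinarith
    have h4 := le_of_mul_le_mul_left h3 (by positivity)
    linarith
  · have h1 : 2048 * (T * L) ≤ ε ^ 2 * m := by
      have := mul_le_mul_of_nonneg_left hm1.le (sq_nonneg ε)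
      calc 2048 * (T * L) = ε ^ 2 * (2048 * (T / ε ^ 2 * L)) := by field_simp
        _ ≤ _ := this
    have h2 : ε ^ 2 * m ≤ ε ^ 2 * (4 * T * n) := by gcongr
    have h3 : (T : ℝ) * (512 * L) ≤ T * (ε ^ 2 * n) := by linarith
    have h4 := le_of_mul_le_mul_left h3 (by positivity)
    linarith
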